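/- All graphs are finite and simple. For a graph $G$, let $\alpha(G)$ denote the maximum size of a set of pairwise non-adjacent vertices. $G$ is $k$-connected if $|V(G)| > k$ and $G-S$ is connected for every $S \subseteq V(G)$ with $|S| < k$; $G$ is regular if all its vertices have the same degree; a Hamiltonian path of $G$ is a path in $G$ that contains all vertices of $G$. For each positive integer $k$ there exists an integer $n_0$ (depending only on $k$) such that every $k$-connected regular graph $G$ with $\alpha(G) \le k+2$ and at least $n_0$ vertices has a Hamiltonian path. -/

import Mathlib

namespace SimpleGraph

/-- A finite graph `G` is `k`-connected if it has more than `k` vertices and `G - S` is connected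
for every set `S` of fewer than `k` vertices. -/
def IsKConnected {V : Type*} [Fintype V] (G : SimpleGraph V) (k : ℕ) : Prop :=
  k < Fintype.card V ∧
    ∀ S : Finset V, S.card < k → (G.induce {v : V | v ∉ S}).Connected

/-- `G` is regular: all vertices have the same degree. -/
def IsRegularGraph {V : Type*} (G : SimpleGraph V) [G.LocallyFinite] : Prop :=
  ∃ d : ℕ, G.IsRegularOfDegree d

/-- `G` has a Hamiltonian path: some walk in `G` visits every vertex exactly once. -/
def HasHamiltonianPath {V : Type*} [DecidableEq V] (G : SimpleGraph V) : Prop :=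
  ∃ (u v : V) (p : G.Walk u v), p.IsHamiltonian

end SimpleGraph

namespace SimpleGraph

/-! ### Independent sets and separators -/

variable {V : Type*} {G : SimpleGraph V}

/-! A large graph with `α ≤ k + 2` has large maximum degree, by the greedy bound, so here the common
degree `d` is large. If a longest path `P` misses a vertex, let `H` be a component of `G - P` and
`S` its neighbours on `P`. As in the Chvátal–Erdős argument, the first vertex of `P` and the
successors of `S` are independent and have no neighbours in `H`. With `α ≤ k + 2` and
`k`-connectedness this forces `|S| = k` and makes `H` a clique. Each of the `k + 1` segments cut out
by `S` has at least `|H|` vertices, since otherwise a spanning path of `H` could replace it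
(`exists_clique_of_longest_path`).

Regularity excludes this (`not_exists_clique_of_regular`). The rest `W` of the graph has about `(k +
1) d` vertices, so deleting somewhat fewer than `d` of them still leaves `k + 1` independent ones.
Two further non-adjacent vertices with no neighbours among these would give `α ≥ k + 3`. Hence `H`
is complete to `S` and `S` is a clique, so `H ∪ S` is a `K_{d+1}` and thus a whole component,
against connectedness. -/

theorem IsIndepSet.insert_of_forall_not_adj {I : Set V} (hI : G.IsIndepSet I) {a : V}
    (ha : ∀ v ∈ I, ¬ G.Adj a v) : G.IsIndepSet (insert a I) :=
  Set.Pairwise.insert hI fun b hb _ => ⟨ha b hb, fun h => ha b hb h.symm⟩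

/-- Greedy bound: a large vertex set in a graph of bounded degree contains an independent set. -/
theorem exists_isIndepSet_of_mul_lt_card [Fintype V] [DecidableEq V] [DecidableRel G.Adj] {d : ℕ}
    (hd : ∀ v, G.degree v ≤ d) (m : ℕ) (X : Finset V) (hX : m * (d + 1) < X.card) :
    ∃ I ⊆ X, G.IsIndepSet (I : Set V) ∧ I.card = m + 1 := by
  induction m generalizing X with
  | zero =>
    obtain ⟨x, hx⟩ := Finset.card_pos.1 (by omega : 0 < X.card)
    exact ⟨{x}, by simpa using hx, by simp [IsIndepSet], by simp⟩
  | succ m ih =>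
    obtain ⟨x, hx⟩ := Finset.card_pos.1 (by omega : 0 < X.card)
    have h1 : (insert x (G.neighborFinset x)).card ≤ d + 1 :=
      (Finset.card_insert_le _ _).trans (by simpa using hd x)
    have h2 := Finset.le_card_sdiff (insert x (G.neighborFinset x)) X
    obtain ⟨I, hIX, hI, hc⟩ := ih (X \ insert x (G.neighborFinset x)) (by
      rw [add_mul] at hX; omega)
    have hnot : ∀ v ∈ I, v ≠ x ∧ ¬ G.Adj x v := fun v hv => by
      have := hIX hv
      simp only [Finset.mem_sdiff, Finset.mem_insert, mem_neighborFinset, not_or] at this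
      exact this.2
    refine ⟨insert x I, ?_, ?_, ?_⟩
    · exact Finset.insert_subset hx (hIX.trans Finset.sdiff_subset)
    · rw [Finset.coe_insert]
      exact hI.insert_of_forall_not_adj fun v hv => (hnot v hv).2
    · rw [Finset.card_insert_of_notMem fun h => (hnot x h).1 rfl, hc]

/-- A set separating a nonempty set from some vertex of a `k`-connected graph has at least `k`
elements. -/
theorem IsKConnected.le_card_of_separates [Fintype V] [DecidableEq V] {k : ℕ}
    (hG : G.IsKConnected k) {X Y : Finset V} (hX : X.Nonempty) (hXY : Disjoint X Y)
    (hN : ∀ x ∈ X, ∀ y, G.Adj x y → y ∈ X ∪ Y) {w : V} (hw : w ∉ X ∪ Y) : k ≤ Y.card := by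
  by_contra! hlt
  obtain ⟨x, hx⟩ := hX
  have hxY : x ∉ Y := Finset.disjoint_left.1 hXY hx
  have hwY : w ∉ Y := fun h => hw (Finset.mem_union_right _ h)
  obtain ⟨p⟩ := (hG.2 Y hlt).preconnected ⟨x, hxY⟩ ⟨w, hwY⟩
  have key : ∀ (a b : {v : V | v ∉ Y}) (_ : (G.induce {v : V | v ∉ Y}).Walk a b),
      (a : V) ∈ X → (b : V) ∈ X := by
    intro a b q
    induction q with
    | nil => exact id
    | @cons u v _ h _ ih =>
      intro ha
      exact ih ((Finset.mem_union.1 (hN _ ha _ h)).resolve_right v.2)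
  exact hw (Finset.mem_union_left _ (key _ _ p hx))

/-! ### Regularity excludes the extremal structure -/

/-- A regular `k`-connected graph with independence number at most `k + 2` and large degree has no
clique `H` whose neighbourhood has `k` elements and is small in comparison with the rest. -/
theorem not_exists_clique_of_regular [Fintype V] [DecidableEq V] [DecidableRel G.Adj] {k d : ℕ}
    (hk : 1 ≤ k) (hG : G.IsKConnected k) (hreg : G.IsRegularOfDegree d)
    (hα : G.indepNum ≤ k + 2) (hd : k * (k * (k + 1)) + k * (k + 1) + 4 * k ≤ d)
    {H S : Finset V} (hHS : Disjoint H S) (hH : G.IsClique (H : Set V)) (hHne : H.Nonempty)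
    (hN : ∀ v ∈ H, ∀ w, G.Adj v w → w ∈ H ∪ S) (hS : ∀ s ∈ S, ∃ v ∈ H, G.Adj s v)
    (hSk : S.card = k) (hW : (k + 1) * H.card ≤ ((H ∪ S)ᶜ).card) : False := by
  set W := (H ∪ S)ᶜ with hWdef
  have hdeg : ∀ v, G.degree v ≤ d := fun v => (hreg v).le
  have hdisjHW : ∀ v ∈ H, v ∉ W := fun v hv => by simp [hWdef, hv]
  have hdisjSW : ∀ v ∈ S, v ∉ W := fun v hv => by simp [hWdef, hv]
  have hHW : ∀ v ∈ H, ∀ w ∈ W, ¬ G.Adj v w := fun v hv w hw hvw => by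
    have := hN v hv w hvw
    simp only [hWdef, Finset.mem_compl] at hw
    exact hw this
  -- sizes
  have hnbr : ∀ v ∈ H, G.neighborFinset v ⊆ H.erase v ∪ S := fun v hv w hw => by
    have hvw := (mem_neighborFinset ..).1 hw
    have := hN v hv w hvw
    simp only [Finset.mem_union, Finset.mem_erase] at this ⊢
    exact this.imp_left fun h => ⟨hvw.ne', h⟩
  have hHd : d + 1 ≤ H.card + k := by
    obtain ⟨v, hv⟩ := hHne
    have h1 := Finset.card_le_card (hnbr v hv)
    rw [card_neighborFinset_eq_degree, hreg v] at h1
    have h2 := Finset.card_union_le (H.erase v) S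
    rw [Finset.card_erase_of_mem hv] at h2
    have := Finset.card_pos.2 ⟨v, hv⟩
    omega
  -- The surplus of `|W|` over `k (d + 1)` is the number of vertices of `W` that can be discarded
  -- before the greedy choice of `k + 1` independent ones.
  have hW' : k * (d + 1) + (d + 1) ≤ W.card + k * (k + 1) := by
    have := Nat.mul_le_mul_left (k + 1) hHd
    nlinarith
  have hWne : ∃ w, w ∈ W := Finset.card_pos.1
    (lt_of_lt_of_le (Nat.mul_pos k.succ_pos hHne.card_pos) hW)
  have hsplit : ∀ s, (G.neighborFinset s ∩ W).card + (G.neighborFinset s ∩ H).card ≤ d := by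
    intro s
    rw [← Finset.card_union_of_disjoint, ← hreg s, ← card_neighborFinset_eq_degree]
    · exact Finset.card_le_card
        (Finset.union_subset Finset.inter_subset_left Finset.inter_subset_left)
    · rw [Finset.disjoint_left]
      intro a ha hb
      exact hdisjHW a (Finset.mem_inter.1 hb).2 (Finset.mem_inter.1 ha).2
  -- vertices of `S` which are not complete to `H` have few neighbours in `H`
  have hbad : ∀ s ∈ S, (∃ v ∈ H, ¬ G.Adj s v) →
      (G.neighborFinset s ∩ H).card ≤ k * (k + 1) := by
    rintro s hs ⟨v, hv, hsv⟩
    by_contra! hlt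
    have h1 := hsplit s
    have h2 := Finset.card_sdiff_add_card_inter W (G.neighborFinset s)
    rw [Finset.inter_comm] at h2
    -- Neighbours of `s` in `H` use up its degree, so it has fewer than `d - k (k + 1)` in `W`.
    -- Adding `s` and `v` to `I` gives `k + 3` independent vertices.
    obtain ⟨I, hIX, hI, hc⟩ := exists_isIndepSet_of_mul_lt_card hdeg k
      (W \ G.neighborFinset s) (by omega)
    have hIW : ∀ w ∈ I, w ∈ W ∧ ¬ G.Adj s w := fun w hw => by
      simpa using hIX hw
    have hvI : v ∉ I := fun h => hdisjHW v hv (hIW v h).1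
    have hsI : s ∉ insert v I := fun h => by
      rcases Finset.mem_insert.1 h with rfl | h
      · exact Finset.disjoint_left.1 hHS hv hs
      · exact hdisjSW s hs (hIW s h).1
    have h3 : G.IsIndepSet ((insert s (insert v I) : Finset V) : Set V) := by
      rw [Finset.coe_insert, Finset.coe_insert]
      refine (hI.insert_of_forall_not_adj fun w hw => hHW v hv w (hIW w hw).1)
        |>.insert_of_forall_not_adj ?_
      rintro w (rfl | hw)
      · exact hsv
      · exact (hIW w hw).2
    have h4 := h3.card_le_indepNum
    rw [Finset.card_insert_of_notMem hsI, Finset.card_insert_of_notMem hvI, hc] at h4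
    omega
  set B := S.filter (fun s => ∃ v ∈ H, ¬ G.Adj s v) with hB
  -- some vertex of `H` has no neighbour in `B`
  obtain ⟨h₀, hh₀, hh₀B⟩ : ∃ v ∈ H, ∀ s ∈ B, ¬ G.Adj s v := by
    by_contra! hcon
    have hsub : H ⊆ B.biUnion (fun s => G.neighborFinset s ∩ H) := fun v hv => by
      obtain ⟨s, hs, hsv⟩ := hcon v hv
      simp only [Finset.mem_biUnion, Finset.mem_inter, mem_neighborFinset]
      exact ⟨s, hs, hsv, hv⟩
    have h1 := (Finset.card_le_card hsub).trans
      (Finset.card_biUnion_le_card_mul B _ (k * (k + 1)) fun s hs => by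
        rw [hB, Finset.mem_filter] at hs
        exact hbad s hs.1 hs.2)
    have h2 : B.card ≤ k := hSk ▸ Finset.card_filter_le _ _
    have h3 := Nat.mul_le_mul_right (k * (k + 1)) h2
    have h4 : k * 1 ≤ k * (k + 1) := Nat.mul_le_mul_left k (by omega)
    omega
  have hcompl : ∀ s ∈ S \ B, ∀ v ∈ H, G.Adj s v := fun s hs v hv => by
    by_contra h
    exact (Finset.mem_sdiff.1 hs).2 (Finset.mem_filter.2 ⟨(Finset.mem_sdiff.1 hs).1, v, hv, h⟩)
  have hd_le : d + 1 ≤ H.card + (S \ B).card := by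
    have h1 : G.neighborFinset h₀ ⊆ H.erase h₀ ∪ (S \ B) := fun w hw => by
      have h2 := hnbr h₀ hh₀ hw
      rw [Finset.mem_union] at h2 ⊢
      refine h2.imp_right fun h => Finset.mem_sdiff.2 ⟨h, fun hwB => hh₀B w hwB ?_⟩
      exact ((mem_neighborFinset ..).1 hw).symm
    have h2 := (Finset.card_le_card h1).trans (Finset.card_union_le _ _)
    rw [card_neighborFinset_eq_degree, hreg h₀, Finset.card_erase_of_mem hh₀] at h2
    have := Finset.card_pos.2 hHne
    omega
  have hSall : ∀ s ∈ S, ∀ v ∈ H, G.Adj s v := by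
    intro s hs
    refine hcompl s (Finset.mem_sdiff.2 ⟨hs, fun hsB => ?_⟩)
    obtain ⟨v, hv, hsv⟩ := hS s hs
    -- A neighbour `s ∈ B` would raise the degree of `v` above that of `h₀`, which has no neighbour
    -- in `B`.
    have h1 : insert s (H.erase v ∪ (S \ B)) ⊆ G.neighborFinset v := by
      intro w hw
      rw [mem_neighborFinset]
      simp only [Finset.mem_insert, Finset.mem_union, Finset.mem_erase] at hw
      rcases hw with rfl | ⟨hne, hw⟩ | hw
      · exact hsv.symm
      · exact hH hv hw hne.symm
      · exact (hcompl w hw v hv).symm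
    have h2 := Finset.card_le_card h1
    have hdj : Disjoint (H.erase v) (S \ B) :=
      hHS.mono (Finset.erase_subset _ _) Finset.sdiff_subset
    have hsn : s ∉ H.erase v ∪ (S \ B) := by
      rw [Finset.mem_union, Finset.mem_erase, Finset.mem_sdiff]
      rintro (h | h)
      · exact Finset.disjoint_left.1 hHS h.2 hs
      · exact h.2 hsB
    rw [card_neighborFinset_eq_degree, hreg v, Finset.card_insert_of_notMem hsn,
      Finset.card_union_of_disjoint hdj, Finset.card_erase_of_mem hv] at h2
    have := Finset.card_pos.2 hHne
    omega
  have hdeq : H.card + k = d + 1 := by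
    refine le_antisymm ?_ hHd
    have h1 : H.erase h₀ ∪ S ⊆ G.neighborFinset h₀ := by
      intro w hw
      rw [mem_neighborFinset]
      simp only [Finset.mem_union, Finset.mem_erase] at hw
      rcases hw with ⟨hne, hw⟩ | hw
      · exact hH hh₀ hw hne.symm
      · exact (hSall w hw h₀ hh₀).symm
    have h2 := Finset.card_le_card h1
    rw [card_neighborFinset_eq_degree, hreg h₀, Finset.card_union_of_disjoint
      (hHS.mono_left (Finset.erase_subset _ _)), Finset.card_erase_of_mem hh₀] at h2
    omega
  have hSW : ∀ s ∈ S, (G.neighborFinset s ∩ W).card ≤ k := by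
    intro s hs
    have h1 := hsplit s
    have h2 : G.neighborFinset s ∩ H = H := Finset.inter_eq_right.2 fun v hv =>
      (mem_neighborFinset ..).2 (hSall s hs v hv)
    rw [h2] at h1
    omega
  have hSclique : G.IsClique (S : Set V) := by
    intro s hs t ht hst
    by_contra hnst
    have h1 := hSW s hs
    have h2 := hSW t ht
    have h3 := Finset.card_sdiff_add_card_inter W (G.neighborFinset s ∪ G.neighborFinset t)
    rw [Finset.inter_union_distrib_left, Finset.inter_comm W, Finset.inter_comm W] at h3
    have h4 := Finset.card_union_le (G.neighborFinset s ∩ W) (G.neighborFinset t ∩ W)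
    -- Only `2 k` vertices of `W` are lost to `s` and `t`.
    obtain ⟨I, hIX, hI, hc⟩ := exists_isIndepSet_of_mul_lt_card hdeg k
      (W \ (G.neighborFinset s ∪ G.neighborFinset t)) (by omega)
    have hIW : ∀ w ∈ I, w ∈ W ∧ ¬ G.Adj s w ∧ ¬ G.Adj t w := fun w hw => by
      simpa using hIX hw
    have htI : t ∉ I := fun h => hdisjSW t ht (hIW t h).1
    have hsI : s ∉ insert t I := fun h => by
      rcases Finset.mem_insert.1 h with h | h
      · exact hst h
      · exact hdisjSW s hs (hIW s h).1
    have h5 : G.IsIndepSet ((insert s (insert t I) : Finset V) : Set V) := by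
      rw [Finset.coe_insert, Finset.coe_insert]
      refine (hI.insert_of_forall_not_adj fun w hw => (hIW w hw).2.2)
        |>.insert_of_forall_not_adj ?_
      rintro w (rfl | hw)
      · exact hnst
      · exact (hIW w hw).2.1
    have h6 := h5.card_le_indepNum
    rw [Finset.card_insert_of_notMem hsI, Finset.card_insert_of_notMem htI, hc] at h6
    omega
  -- `H ∪ S` is closed under adjacency
  obtain ⟨w, hw⟩ := hWne
  have hclosed : ∀ x ∈ H ∪ S, ∀ y, G.Adj x y → y ∈ (H ∪ S) ∪ (∅ : Finset V) := by
    intro x hx y hxy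
    rw [Finset.union_empty]
    have h1 : (H ∪ S).erase x ⊆ G.neighborFinset x := by
      intro z hz
      rw [mem_neighborFinset]
      rw [Finset.mem_erase, Finset.mem_union] at hz
      rcases Finset.mem_union.1 hx with hx | hx <;> rcases hz.2 with h | h
      · exact hH hx h hz.1.symm
      · exact (hSall z h x hx).symm
      · exact hSall x hx z h
      · exact hSclique hx h hz.1.symm
    have h2 : (H ∪ S).erase x = G.neighborFinset x := by
      refine Finset.eq_of_subset_of_card_le h1 ?_
      rw [card_neighborFinset_eq_degree, hreg x, Finset.card_erase_of_mem hx,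
        Finset.card_union_of_disjoint hHS]
      omega
    have h3 : y ∈ (H ∪ S).erase x := h2 ▸ (mem_neighborFinset ..).2 hxy
    exact Finset.mem_of_mem_erase h3
  -- The empty set separates `H ∪ S` from `w`, so `k ≤ 0`.
  have := hG.le_card_of_separates (hHne.mono Finset.subset_union_left)
    (Finset.disjoint_empty_right _) hclosed (w := w) (by simpa [hWdef] using hw)
  simp at this
  omega


/-! ### Path surgery -/

/-- A list of distinct vertices in which consecutive vertices are adjacent. -/
def IsPathList (G : SimpleGraph V) (l : List V) : Prop :=
  l.IsChain G.Adj ∧ l.Nodup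

/-- `q` is a nonempty path inside `H` whose first vertex is adjacent to `a` (if there is such a
vertex) and whose last vertex is adjacent to `b` (if there is such a vertex). -/
structure IsLink (G : SimpleGraph V) (H : Finset V) (a b : Option V) (q : List V) : Prop where
  ne_nil : q ≠ []
  isPathList : G.IsPathList q
  mem : ∀ v ∈ q, v ∈ H
  adj_head : ∀ x ∈ a, ∀ y ∈ q.head?, G.Adj x y
  adj_last : ∀ x ∈ q.getLast?, ∀ y ∈ b, G.Adj x y

theorem IsPathList.hasHamiltonianPath [DecidableEq V] {l : List V} (hl : G.IsPathList l)
    (hne : l ≠ []) (hall : ∀ v, v ∈ l) : G.HasHamiltonianPath := by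
  refine ⟨_, _, Walk.ofSupport l hne hl.1, fun v => ?_⟩
  rw [Walk.support_ofSupport]
  exact List.count_eq_one_of_mem hl.2 (hall v)

/-- A segment of a path may be replaced by a link between its neighbours on the path. -/
theorem IsPathList.replace {A M C q : List V} {H : Finset V} (hP : G.IsPathList (A ++ M ++ C))
    (hH : ∀ v ∈ H, v ∉ A ++ M ++ C) (hq : G.IsLink H A.getLast? C.head? q) :
    G.IsPathList (A ++ q ++ C) := by
  obtain ⟨hc, hn⟩ := hP
  have hqH := hq.mem
  simp only [List.isChain_append, List.nodup_append', List.disjoint_left, List.mem_append]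
    at hc hn hH
  refine ⟨?_, ?_⟩
  · simp only [List.isChain_append]
    refine ⟨⟨hc.1.1, hq.isPathList.1, hq.adj_head⟩, hc.2.1, fun x hx => ?_⟩
    rw [List.getLast?_append_of_ne_nil _ hq.ne_nil] at hx
    exact hq.adj_last x hx
  · simp only [List.nodup_append', List.disjoint_left, List.mem_append]
    refine ⟨⟨hn.1.1, hq.isPathList.2, fun v hv hvq => hH v (hqH v hvq) (by tauto)⟩, hn.2.1, ?_⟩
    rintro v (hv | hv) hvC
    · exact hn.2.2 (Or.inl hv) hvC
    · exact hH v (hqH v hv) (by tauto)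

/-- Rerouting a path through a link, reversing the middle segment. -/
theorem IsPathList.reroute {A B C q : List V} {H : Finset V} (hP : G.IsPathList (A ++ B ++ C))
    (hB : B ≠ []) (hH : ∀ v ∈ H, v ∉ A ++ B ++ C) (hq : G.IsLink H A.getLast? B.getLast? q)
    (hBC : ∀ x ∈ B.head?, ∀ y ∈ C.head?, G.Adj x y) :
    G.IsPathList (A ++ q ++ B.reverse ++ C) := by
  obtain ⟨hc, hn⟩ := hP
  have hqH := hq.mem
  simp only [List.isChain_append, List.nodup_append', List.disjoint_left, List.mem_append]
    at hc hn hH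
  refine ⟨?_, ?_⟩
  · simp only [List.isChain_append]
    refine ⟨⟨⟨hc.1.1, hq.isPathList.1, hq.adj_head⟩, ?_, fun x hx => ?_⟩, hc.2.1, fun x hx => ?_⟩
    · rw [List.isChain_reverse]
      exact hc.1.2.1.imp fun _ _ h => h.symm
    · rw [List.getLast?_append_of_ne_nil _ hq.ne_nil] at hx
      rw [List.head?_reverse]
      exact hq.adj_last x hx
    · rw [List.getLast?_append_of_ne_nil _ (by simpa using hB), List.getLast?_reverse] at hx
      exact hBC x hx
  · simp only [List.nodup_append', List.disjoint_left, List.mem_append, List.mem_reverse,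
      List.nodup_reverse]
    refine ⟨⟨⟨hn.1.1, hq.isPathList.2, fun v hv hvq => hH v (hqH v hvq) (by tauto)⟩,
      hn.1.2.1, ?_⟩, hn.2.1, ?_⟩
    · rintro v (hv | hv) hvB
      · exact hn.1.2.2 hv hvB
      · exact hH v (hqH v hv) (by tauto)
    · rintro v ((hv | hv) | hv) hvC
      · exact hn.2.2 (Or.inl hv) hvC
      · exact hH v (hqH v hv) (by tauto)
      · exact hn.2.2 (Or.inr hv) hvC

/-- Any two vertices of `H` are joined by a path inside `H`. -/
def IsPathJoined (G : SimpleGraph V) (H : Finset V) : Prop :=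
  ∀ u ∈ H, ∀ v ∈ H, ∃ q : List V, G.IsPathList q ∧ (∀ x ∈ q, x ∈ H) ∧
    q.head? = some u ∧ q.getLast? = some v

/-- The chosen neighbours of `a` and `b` may coincide; a one-vertex link already suffices to
lengthen a path. -/
theorem IsPathJoined.exists_isLink {H : Finset V} (hH : G.IsPathJoined H) (hne : H.Nonempty)
    {a b : Option V} (ha : ∀ x ∈ a, ∃ v ∈ H, G.Adj x v) (hb : ∀ x ∈ b, ∃ v ∈ H, G.Adj x v) :
    ∃ q, G.IsLink H a b q := by
  have key : ∀ c : Option V, (∀ x ∈ c, ∃ v ∈ H, G.Adj x v) → ∃ u ∈ H, ∀ x ∈ c, G.Adj x u := by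
    rintro (_ | c) hc
    · obtain ⟨u, hu⟩ := hne
      exact ⟨u, hu, by simp⟩
    · obtain ⟨u, hu, h⟩ := hc c rfl
      exact ⟨u, hu, by simpa using h⟩
  obtain ⟨u, hu, hau⟩ := key a ha
  obtain ⟨v, hv, hbv⟩ := key b hb
  obtain ⟨q, hq, hqH, hqu, hqv⟩ := hH u hu v hv
  refine ⟨q, ⟨?_, hq, hqH, ?_, ?_⟩⟩
  · rintro rfl
    simp at hqu
  · rw [hqu]
    simpa using hau
  · rw [hqv]
    intro x hx y hy
    obtain rfl : v = x := by simpa using hx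
    exact (hbv y hy).symm

/-- In a clique with at least two vertices there are spanning links. -/
theorem exists_isLink_length_eq_card [DecidableEq V] {H : Finset V} (hH : G.IsClique (H : Set V))
    (hcard : 2 ≤ H.card) {a b : Option V} (ha : ∀ x ∈ a, ∃ v ∈ H, G.Adj x v)
    (hb : ∀ x ∈ b, ∃ v ∈ H, G.Adj x v)
    (hab : ∀ x ∈ a, ∀ y ∈ b, ∃ u ∈ H, ∃ v ∈ H, u ≠ v ∧ G.Adj x u ∧ G.Adj y v) :
    ∃ q, G.IsLink H a b q ∧ q.length = H.card := by
  obtain ⟨u, hu, v, hv, huv, hau, hbv⟩ : ∃ u ∈ H, ∃ v ∈ H, u ≠ v ∧ (∀ x ∈ a, G.Adj x u) ∧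
      ∀ y ∈ b, G.Adj y v := by
    rcases a with _ | a <;> rcases b with _ | b
    · obtain ⟨u, hu, v, hv, huv⟩ := Finset.one_lt_card.1 hcard
      exact ⟨u, hu, v, hv, huv, by simp, by simp⟩
    · obtain ⟨v, hv, h⟩ := hb b rfl
      obtain ⟨u, hu, huv⟩ := Finset.exists_mem_ne hcard v
      exact ⟨u, hu, v, hv, huv, by simp, by simpa using h⟩
    · obtain ⟨v, hv, h⟩ := ha a rfl
      obtain ⟨u, hu, huv⟩ := Finset.exists_mem_ne hcard v
      exact ⟨v, hv, u, hu, huv.symm, by simpa using h, by simp⟩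
    · obtain ⟨u, hu, v, hv, huv, h1, h2⟩ := hab a rfl b rfl
      exact ⟨u, hu, v, hv, huv, by simpa using h1, by simpa using h2⟩
  set l := ((H.erase u).erase v).toList with hl
  have hlmem : ∀ x, x ∈ l ↔ x ≠ v ∧ x ≠ u ∧ x ∈ H := by simp [hl]
  have hnodup : (u :: (l ++ [v])).Nodup := by
    have : l.Nodup := Finset.nodup_toList _
    simp only [List.nodup_cons, List.nodup_append', List.mem_append, List.disjoint_left, hlmem]
    simp +contextual [huv, this]
  have hmem : ∀ x ∈ u :: (l ++ [v]), x ∈ H := by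
    intro x hx
    simp only [List.mem_cons, List.mem_append, hlmem, List.not_mem_nil, or_false] at hx
    rcases hx with rfl | h | rfl
    · exact hu
    · exact h.2.2
    · exact hv
  refine ⟨u :: (l ++ [v]), ⟨by simp, ⟨?_, hnodup⟩, hmem, ?_, ?_⟩, ?_⟩
  · refine List.Pairwise.isChain ?_
    exact List.Pairwise.imp_of_mem (fun ha hb hne => hH (hmem _ ha) (hmem _ hb) hne) hnodup
  · simpa using hau
  · intro x hx y hy
    obtain rfl : v = x := by
      rw [← List.cons_append, List.getLast?_append_of_ne_nil _ (by simp)] at hx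
      simpa using hx
    exact (hbv y hy).symm
  · have := Finset.card_pos.2 ⟨u, hu⟩
    simp [hl, Finset.card_erase_of_mem, hu, hv, huv.symm]
    omega

/-- A component of the graph outside a list of vertices. -/
theorem exists_component_compl [Fintype V] (P : List V) {h₀ : V} (h0 : h₀ ∉ P) :
    ∃ H : Finset V, H.Nonempty ∧ (∀ v ∈ H, v ∉ P) ∧ (∀ v ∈ H, ∀ w, G.Adj v w → w ∉ P → w ∈ H) ∧
      G.IsPathJoined H := by
  classical
  -- Vertices of `P` become isolated, so walks from `h₀` avoid `P` without passing to a subtype.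
  let G' : SimpleGraph V :=
    { Adj := fun a b => G.Adj a b ∧ a ∉ P ∧ b ∉ P
      symm := ⟨fun a b h => ⟨h.1.symm, h.2.2, h.2.1⟩⟩
      loopless := ⟨fun a h => G.loopless.irrefl a h.1⟩ }
  have hout : ∀ (a b : V) (_ : G'.Walk a b), a ∉ P → b ∉ P := by
    intro a b p
    induction p with
    | nil => exact id
    | cons h _ ih => exact fun _ => ih h.2.2
  refine ⟨Finset.univ.filter (G'.Reachable h₀), ⟨h₀, by simp⟩, ?_, ?_, ?_⟩
  · rintro v hv
    obtain ⟨p⟩ := (Finset.mem_filter.1 hv).2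
    exact hout _ _ p h0
  · intro v hv w hvw hw
    obtain ⟨p⟩ := (Finset.mem_filter.1 hv).2
    refine Finset.mem_filter.2 ⟨Finset.mem_univ _, ?_⟩
    have : G'.Adj v w := ⟨hvw, hout _ _ p h0, hw⟩
    exact Reachable.trans ⟨p⟩ this.reachable
  · intro u hu v hv
    have hu' := (Finset.mem_filter.1 hu).2
    obtain ⟨p, hp⟩ := (hu'.symm.trans (Finset.mem_filter.1 hv).2).exists_isPath
    refine ⟨p.support, ⟨p.isChain_adj_support.imp fun _ _ h => h.1, hp.support_nodup⟩, ?_, ?_, ?_⟩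
    · intro x hx
      exact Finset.mem_filter.2 ⟨Finset.mem_univ _, hu'.trans ⟨p.takeUntil x hx⟩⟩
    · rw [List.head?_eq_some_head p.support_ne_nil, Walk.head_support]
    · rw [List.getLast?_eq_some_getLast p.support_ne_nil, Walk.getLast_support]


/-! ### Structure around a longest path -/

/-- If two vertices outside a clique `H` do not have distinct neighbours in `H`, then their
common neighbour and the rest of the neighbourhood of `H` form a small separator. -/
theorem IsKConnected.exists_ne_adj [Fintype V] [DecidableEq V] {k : ℕ} (hG : G.IsKConnected k)
    {H S : Finset V} (hHS : Disjoint H S) (hcard : 2 ≤ H.card) (hSk : S.card = k)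
    (hN : ∀ v ∈ H, ∀ w, G.Adj v w → w ∈ H ∪ S) (hS : ∀ s ∈ S, ∃ v ∈ H, G.Adj s v)
    {w : V} (hw : w ∉ H ∪ S) {s t : V} (hs : s ∈ S) (ht : t ∈ S) (hst : s ≠ t) :
    ∃ u ∈ H, ∃ v ∈ H, u ≠ v ∧ G.Adj s u ∧ G.Adj t v := by
  by_contra! hcon
  obtain ⟨u, hu, hsu⟩ := hS s hs
  obtain ⟨v, hv, htv⟩ := hS t ht
  have hsu' : ∀ x ∈ H, G.Adj s x → x = u := by
    intro x hx hsx
    have h1 : x = v := by_contra fun h => hcon x hx v hv h hsx htv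
    have h2 : u = v := by_contra fun h => hcon u hu v hv h hsu htv
    rw [h1, h2]
  have htu' : ∀ x ∈ H, G.Adj t x → x = u := by
    intro x hx htx
    exact (by_contra fun h => hcon u hu x hx h hsu htx : u = x).symm
  have huS : u ∉ S := Finset.disjoint_left.1 hHS hu
  -- Since `s` and `t` see only `u` in `H`, replacing both by `u` gives a separator of size `k - 1`.
  have h1 := hG.le_card_of_separates (X := H.erase u) (Y := insert u ((S.erase s).erase t))
    (w := w) (Finset.card_pos.1 (by rw [Finset.card_erase_of_mem hu]; omega)) ?_ ?_ ?_
  · rw [Finset.card_insert_of_notMem (by simp [huS]),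
      Finset.card_erase_of_mem (Finset.mem_erase.2 ⟨hst.symm, ht⟩),
      Finset.card_erase_of_mem hs] at h1
    have := Finset.one_lt_card.2 ⟨s, hs, t, ht, hst⟩
    omega
  · rw [Finset.disjoint_left]
    intro x hx hx'
    simp only [Finset.mem_erase, Finset.mem_insert] at hx hx'
    rcases hx' with h | h
    · exact hx.1 h
    · exact Finset.disjoint_left.1 hHS hx.2 h.2.2
  · intro x hx y hxy
    rw [Finset.mem_erase] at hx
    have h2 := hN x hx.2 y hxy
    have h3 : y ≠ s := by
      rintro rfl
      exact hx.1 (hsu' x hx.2 hxy.symm)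
    have h4 : y ≠ t := by
      rintro rfl
      exact hx.1 (htu' x hx.2 hxy.symm)
    simp only [Finset.mem_union, Finset.mem_erase, Finset.mem_insert] at h2 ⊢
    tauto
  · have hwu : w ≠ u := by
      rintro rfl
      exact hw (Finset.mem_union_left _ hu)
    simp only [Finset.mem_union, Finset.mem_erase, Finset.mem_insert] at hw ⊢
    tauto

/-- The structure around a longest path missing a vertex of a `k`-connected graph with
independence number at most `k + 2`. -/
theorem exists_clique_of_longest_path [Fintype V] [DecidableEq V] {k d : ℕ}
    (hG : G.IsKConnected k) (hα : G.indepNum ≤ k + 2) [DecidableRel G.Adj]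
    (hdeg : ∀ v, d ≤ G.degree v) (hd : k + 1 ≤ d) {P : List V} (hP : G.IsPathList P)
    (hmax : ∀ l, G.IsPathList l → l.length ≤ P.length) {h₀ : V} (h0 : h₀ ∉ P) :
    ∃ H S : Finset V, Disjoint H S ∧ G.IsClique (H : Set V) ∧ H.Nonempty ∧
      (∀ v ∈ H, ∀ w, G.Adj v w → w ∈ H ∪ S) ∧ (∀ s ∈ S, ∃ v ∈ H, G.Adj s v) ∧ S.card = k ∧
      (k + 1) * H.card ≤ ((H ∪ S)ᶜ).card := by
  obtain ⟨H, hHne, hHP, hHcl, hHj⟩ := exists_component_compl (G := G) P h0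
  set S : Finset V := P.toFinset.filter (fun s => ∃ v ∈ H, G.Adj s v) with hSdef
  have hS : ∀ s ∈ S, ∃ v ∈ H, G.Adj s v := fun s hs => (Finset.mem_filter.1 hs).2
  have hSP : ∀ s ∈ S, s ∈ P := fun s hs => List.mem_toFinset.1 (Finset.mem_filter.1 hs).1
  have hmemS : ∀ s ∈ P, ∀ v ∈ H, G.Adj s v → s ∈ S := fun s hs v hv h =>
    Finset.mem_filter.2 ⟨List.mem_toFinset.2 hs, v, hv, h⟩
  have hHS : Disjoint H S := Finset.disjoint_left.2 fun v hv hvS => hHP v hv (hSP v hvS)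
  have hN : ∀ v ∈ H, ∀ w, G.Adj v w → w ∈ H ∪ S := by
    intro v hv w hvw
    by_cases hw : w ∈ P
    · exact Finset.mem_union_right _ (hmemS w hw v hv hvw.symm)
    · exact Finset.mem_union_left _ (hHcl v hv w hvw hw)
  -- positions on the path which start a segment
  set T := (Finset.range (P.length + 1)).filter (fun t => ∀ x ∈ (P.take t).getLast?, x ∈ S)
    with hT
  -- The default `h₀` plays no role: `f` is only evaluated at positions on `P`.
  set f : ℕ → V := fun i => P.getD i h₀ with hf
  have hfget : ∀ i < P.length, P[i]? = some (f i) := fun i hi => by simp [hf, hi]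
  have hfP : ∀ i < P.length, f i ∈ P := fun i hi => List.mem_of_getElem? (hfget i hi)
  have hfinj : ∀ i < P.length, ∀ j < P.length, f i = f j → i = j := by
    intro i hi j hj hij
    have : P[i]? = P[j]? := by rw [hfget i hi, hfget j hj, hij]
    exact (List.getElem?_inj hi hP.2).1 this
  have hlast : ∀ t < P.length, (P.take (t + 1)).getLast? = some (f t) := by
    intro t ht
    simp [List.getLast?_take, hfget t ht]
  -- Position `0` has no predecessor; it accounts for the extra one in `|S| + 1 ≤ |T|`.
  have hzero : 0 ∈ T := by simp [hT]
  have hsuccT : ∀ t < P.length, f t ∈ S → t + 1 ∈ T := by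
    intro t ht hts
    simp only [hT, Finset.mem_filter, Finset.mem_range, hlast t ht]
    exact ⟨by omega, by simpa using hts⟩
  have hTS : ∀ t, t + 1 ∈ T → t < P.length ∧ f t ∈ S := by
    intro t ht
    simp only [hT, Finset.mem_filter, Finset.mem_range] at ht
    have h1 : t < P.length := by omega
    rw [hlast t h1] at ht
    exact ⟨h1, ht.2 _ rfl⟩
  have hTnbr : ∀ t ∈ T, ∀ x ∈ (P.take t).getLast?, ∃ v ∈ H, G.Adj x v := fun t ht x hx =>
    hS x ((Finset.mem_filter.1 ht).2 x hx)
  have hTle : ∀ t ∈ T, t ≤ P.length := fun t ht => by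
    have := Finset.mem_range.1 (Finset.mem_filter.1 ht).1
    omega
  -- consequences of maximality
  have hend : ∀ t ∈ T, ∀ q, G.IsLink H (P.take t).getLast? none q →
      t + q.length ≤ P.length := by
    intro t ht q hq
    have h1 : G.IsPathList (P.take t ++ P.drop t ++ []) := by simpa using hP
    have h2 := hmax _ (h1.replace (by simpa using hHP) (by simpa using hq))
    have := hTle t ht
    simp at h2
    omega
  -- The link replaces positions `t, …, t' - 2`; the vertex of `S` at `t' - 1` stays, whence the `+
  -- 1`.
  have hmid : ∀ t ∈ T, ∀ t' ∈ T, t < t' → ∀ q,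
      G.IsLink H (P.take t).getLast? (P.take t').getLast? q → t + q.length + 1 ≤ t' := by
    intro t ht t' ht' htt' q hq
    obtain ⟨j, rfl⟩ : ∃ j, t' = j + 1 := ⟨t' - 1, by omega⟩
    have hj := (hTS j ht').1
    have hsplit : P.take t ++ (P.take j).drop t ++ P.drop j = P := by
      have : P.take t = (P.take j).take t := by rw [List.take_take, min_eq_left (by omega)]
      rw [this, List.take_append_drop, List.take_append_drop]
    have h1 : G.IsPathList (P.take t ++ (P.take j).drop t ++ P.drop j) := by rwa [hsplit]
    rw [hlast j hj] at hq
    have h2 := hmax _ (h1.replace (by rwa [hsplit])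
      (by rwa [List.head?_drop, hfget j hj]))
    simp at h2
    omega
  -- If the last vertex of `P` were in `S`, the path could be extended into `H`.
  have hlt : ∀ t ∈ T, t < P.length := by
    intro t ht
    obtain ⟨q, hq⟩ := hHj.exists_isLink hHne (hTnbr t ht) (b := none) (by simp)
    have h1 := hend t ht q hq
    have h2 := List.length_pos_iff.2 hq.ne_nil
    omega
  have hnotsucc : ∀ t ∈ T, t + 1 ∉ T := by
    intro t ht ht'
    obtain ⟨q, hq⟩ := hHj.exists_isLink hHne (hTnbr t ht) (hTnbr _ ht')
    have h1 := hmid t ht _ ht' (by omega) q hq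
    have h2 := List.length_pos_iff.2 hq.ne_nil
    omega
  have hnotS : ∀ t ∈ T, f t ∉ S := fun t ht h => hnotsucc t ht (hsuccT t (hlt t ht) h)
  have hnotadjH : ∀ t ∈ T, ∀ v ∈ H, ¬ G.Adj v (f t) := fun t ht v hv h =>
    hnotS t ht (hmemS _ (hfP t (hlt t ht)) v hv h.symm)
  -- Otherwise reroute: enter `H` after position `t - 1`, leave to position `t' - 1`, go back to `f
  -- t` and jump to `f t'`.
  have hnotadj : ∀ t ∈ T, ∀ t' ∈ T, t < t' → ¬ G.Adj (f t) (f t') := by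
    intro t ht t' ht' htt' hadj
    obtain ⟨q, hq⟩ := hHj.exists_isLink hHne (hTnbr t ht) (hTnbr _ ht')
    have htl := hlt t' ht'
    have hsplit : P.take t ++ (P.take t').drop t ++ P.drop t' = P := by
      have : P.take t = (P.take t').take t := by rw [List.take_take, min_eq_left (by omega)]
      rw [this, List.take_append_drop, List.take_append_drop]
    have h1 : G.IsPathList (P.take t ++ (P.take t').drop t ++ P.drop t') := by rwa [hsplit]
    have hBl : ((P.take t').drop t).length = t' - t := by simp; omega
    have hB : (P.take t').drop t ≠ [] := by
      rw [← List.length_pos_iff, hBl]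
      omega
    have hlink : G.IsLink H (P.take t).getLast? ((P.take t').drop t).getLast? q := by
      rw [List.getLast?_drop, if_neg (by simp; omega)]
      exact hq
    have h2 := hmax _ (h1.reroute hB (by rwa [hsplit]) hlink (by
      rw [List.head?_drop, List.head?_drop, List.getElem?_take_of_lt htt', hfget t (by omega),
        hfget t' htl]
      simpa using hadj))
    have h3 := List.length_pos_iff.2 hq.ne_nil
    simp only [List.length_append, List.length_reverse, hBl, List.length_take,
      List.length_drop] at h2
    omega
  -- counting
  have hTcard : S.card + 1 ≤ T.card := by
    have h1 : S ⊆ (T.erase 0).image (fun t => f (t - 1)) := by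
      intro s hs
      obtain ⟨i, hi, rfl⟩ := List.mem_iff_getElem.1 (hSP s hs)
      have h2 : f i = P[i] := by simp [hf, hi]
      rw [← h2] at hs ⊢
      exact Finset.mem_image.2 ⟨i + 1, Finset.mem_erase.2 ⟨by omega, hsuccT i hi hs⟩, by simp⟩
    have h2 := (Finset.card_le_card h1).trans Finset.card_image_le
    rw [Finset.card_erase_of_mem hzero] at h2
    have := Finset.card_pos.2 ⟨0, hzero⟩
    omega
  have hw : f 0 ∉ H ∪ S := by
    rw [Finset.mem_union, not_or]
    exact ⟨fun h => hHP _ h (hfP 0 (hlt 0 hzero)), hnotS 0 hzero⟩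
  have hSk : k ≤ S.card := hG.le_card_of_separates hHne hHS hN hw
  set I := T.image f with hI
  have hIcard : I.card = T.card := Finset.card_image_of_injOn fun i hi j hj h =>
    hfinj i (hlt i hi) j (hlt j hj) h
  have hIind : G.IsIndepSet (I : Set V) := by
    intro x hx y hy hxy
    obtain ⟨t, ht, rfl⟩ := Finset.mem_image.1 (Finset.mem_coe.1 hx)
    obtain ⟨t', ht', rfl⟩ := Finset.mem_image.1 (Finset.mem_coe.1 hy)
    rcases lt_trichotomy t t' with h | rfl | h
    · exact hnotadj t ht t' ht' h
    · exact absurd rfl hxy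
    · exact fun hadj => hnotadj t' ht' t ht h hadj.symm
  have hHI : ∀ v ∈ H, v ∉ I ∧ ∀ w ∈ I, ¬ G.Adj v w := by
    intro v hv
    refine ⟨fun h => ?_, fun w hw => ?_⟩
    · obtain ⟨t, ht, rfl⟩ := Finset.mem_image.1 h
      exact hHP _ hv (hfP t (hlt t ht))
    · obtain ⟨t, ht, rfl⟩ := Finset.mem_image.1 hw
      exact hnotadjH t ht v hv
  have hSeq : S.card = k := by
    obtain ⟨v, hv⟩ := hHne
    have h1 : G.IsIndepSet ((insert v I : Finset V) : Set V) := by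
      rw [Finset.coe_insert]
      exact hIind.insert_of_forall_not_adj (hHI v hv).2
    have h2 := h1.card_le_indepNum
    rw [Finset.card_insert_of_notMem (hHI v hv).1] at h2
    omega
  have hclique : G.IsClique (H : Set V) := by
    intro u hu v hv huv
    by_contra hnadj
    have h1 : G.IsIndepSet ((insert u (insert v I) : Finset V) : Set V) := by
      rw [Finset.coe_insert, Finset.coe_insert]
      refine (hIind.insert_of_forall_not_adj (hHI v hv).2).insert_of_forall_not_adj ?_
      rintro w (rfl | hw)
      · exact hnadj
      · exact (hHI u hu).2 w hw
    have h2 := h1.card_le_indepNum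
    rw [Finset.card_insert_of_notMem, Finset.card_insert_of_notMem (hHI v hv).1] at h2
    · omega
    · rw [Finset.mem_insert, not_or]
      exact ⟨huv, (hHI u hu).1⟩
  have hHcard : 2 ≤ H.card := by
    obtain ⟨v, hv⟩ := hHne
    have h1 : G.neighborFinset v ⊆ H.erase v ∪ S := fun w hw => by
      have hvw := (mem_neighborFinset ..).1 hw
      have := hN v hv w hvw
      simp only [Finset.mem_union, Finset.mem_erase] at this ⊢
      exact this.imp_left fun h => ⟨hvw.ne', h⟩
    have h2 := (Finset.card_le_card h1).trans (Finset.card_union_le _ _)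
    rw [card_neighborFinset_eq_degree, Finset.card_erase_of_mem hv] at h2
    have := hdeg v
    omega
  -- all segments are long
  have hlong : ∀ t ∈ T, t + H.card ≤ P.length := by
    intro t ht
    obtain ⟨q, hq, hql⟩ := exists_isLink_length_eq_card hclique hHcard (hTnbr t ht) (b := none)
      (by simp) (by simp)
    exact hql ▸ hend t ht q hq
  have hgap : ∀ t ∈ T, ∀ t' ∈ T, t < t' → t + H.card + 1 ≤ t' := by
    intro t ht t' ht' htt'
    obtain ⟨q, hq, hql⟩ := exists_isLink_length_eq_card hclique hHcard (hTnbr t ht)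
      (hTnbr t' ht') (by
        intro x hx y hy
        refine hG.exists_ne_adj hHS hHcard hSeq hN hS hw ((Finset.mem_filter.1 ht).2 x hx)
          ((Finset.mem_filter.1 ht').2 y hy) ?_
        rcases t with _ | i
        · simp at hx
        · obtain ⟨j, rfl⟩ : ∃ j, t' = j + 1 := ⟨t' - 1, by omega⟩
          have hi := (hTS i ht).1
          have hj := (hTS j ht').1
          rw [hlast i hi] at hx
          rw [hlast j hj] at hy
          obtain rfl : f i = x := by simpa using hx
          obtain rfl : f j = y := by simpa using hy
          intro h
          have := hfinj i hi j hj h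
          omega)
    exact hql ▸ hmid t ht t' ht' htt' q hq
  refine ⟨H, S, hHS, hclique, hHne, hN, hS, hSeq, ?_⟩
  -- The `|H|` positions from each `t ∈ T` avoid `S`, as a vertex of `S` there would put its
  -- successor in `T` too soon. These blocks are disjoint.
  have hmaps : ∀ p ∈ T ×ˢ Finset.range H.card, f (p.1 + p.2) ∈ (H ∪ S)ᶜ := by
    rintro ⟨t, a⟩ hp
    obtain ⟨ht, ha⟩ := Finset.mem_product.1 hp
    have ha := Finset.mem_range.1 ha
    have hl := hlong t ht
    simp only at ht ha ⊢
    rw [Finset.mem_compl, Finset.mem_union, not_or]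
    refine ⟨fun h => hHP _ h (hfP _ (by omega)), fun h => ?_⟩
    have := hgap t ht _ (hsuccT (t + a) (by omega) h) (by omega)
    omega
  have hinj : Set.InjOn (fun p : ℕ × ℕ => f (p.1 + p.2)) (T ×ˢ Finset.range H.card : Finset _) := by
    rintro ⟨t, a⟩ hp ⟨t', a'⟩ hp' heq
    obtain ⟨ht, ha⟩ := Finset.mem_product.1 (Finset.mem_coe.1 hp)
    obtain ⟨ht', ha'⟩ := Finset.mem_product.1 (Finset.mem_coe.1 hp')
    have ha := Finset.mem_range.1 ha
    have ha' := Finset.mem_range.1 ha'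
    have hl := hlong t ht
    have hl' := hlong t' ht'
    simp only at ht ha ht' ha' heq
    have hsum := hfinj _ (by omega) _ (by omega) heq
    have htt : t = t' := by
      rcases lt_trichotomy t t' with h | h | h
      · have := hgap t ht t' ht' h
        omega
      · exact h
      · have := hgap t' ht' t ht h
        omega
    subst htt
    rw [Prod.mk.injEq]
    exact ⟨rfl, by omega⟩
  have h1 := Finset.card_le_card_of_injOn _ hmaps hinj
  rw [Finset.card_product, Finset.card_range] at h1
  exact (Nat.mul_le_mul_right _ (by omega)).trans h1

theorem exists_longest_isPathList [Fintype V] (G : SimpleGraph V) :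
    ∃ P, G.IsPathList P ∧ ∀ l, G.IsPathList l → l.length ≤ P.length := by
  classical
  have hfin : ∀ l, G.IsPathList l → l.length ≤ Fintype.card V := fun l hl => hl.2.length_le_card
  set Q : ℕ → Prop := fun n => ∃ l, G.IsPathList l ∧ l.length = n with hQ
  have h0 : Q 0 := ⟨[], ⟨by simp, by simp⟩, rfl⟩
  obtain ⟨P, hP, hPl⟩ : Q (Nat.findGreatest Q (Fintype.card V)) :=
    Nat.findGreatest_spec (Nat.zero_le _) h0
  exact ⟨P, hP, fun l hl => hPl ▸ Nat.le_findGreatest (hfin l hl) ⟨l, hl, rfl⟩⟩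

end SimpleGraph

/-! ### The theorem -/

theorem mainTheorem8 (k : ℕ) (hk : 1 ≤ k) :
    ∃ n₀ : ℕ, ∀ (V : Type*) [Fintype V] [DecidableEq V]
      (G : SimpleGraph V) [DecidableRel G.Adj],
      G.IsKConnected k → G.IsRegularGraph → G.indepNum ≤ k + 2 → n₀ ≤ Fintype.card V →
        G.HasHamiltonianPath := by
  -- With `D` the degree bound required above, this is `(k + 2) (D + 1) + 1`: a degree below `D`
  -- would yield `k + 3` independent vertices greedily.
  refine ⟨(k + 2) * (k * (k * (k + 1)) + k * (k + 1) + 4 * k + 1) + 1, ?_⟩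
  intro V _ _ G _ hG hreg hα hn
  obtain ⟨d, hreg⟩ := hreg
  have hreg' : G.IsRegularOfDegree d := fun v => by convert hreg v
  have hd : k * (k * (k + 1)) + k * (k + 1) + 4 * k ≤ d := by
    by_contra! hlt
    obtain ⟨I, -, hI, hc⟩ := SimpleGraph.exists_isIndepSet_of_mul_lt_card
      (fun v => (hreg' v).le) (k + 2) Finset.univ (by
        rw [Finset.card_univ]
        have := Nat.mul_le_mul_left (k + 2) (Nat.succ_le_of_lt hlt)
        rw [Nat.mul_succ] at hn
        rw [Nat.succ_eq_add_one] at this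
        omega)
    have := hI.card_le_indepNum
    omega
  obtain ⟨P, hP, hmax⟩ := G.exists_longest_isPathList
  by_cases hall : ∀ v, v ∈ P
  · refine hP.hasHamiltonianPath ?_ hall
    have : 0 < Fintype.card V := by omega
    obtain ⟨v⟩ := Fintype.card_pos_iff.1 this
    exact List.ne_nil_of_mem (hall v)
  · push Not at hall
    obtain ⟨h₀, h0⟩ := hall
    obtain ⟨H, S, hHS, hH, hHne, hN, hS, hSk, hW⟩ :=
      SimpleGraph.exists_clique_of_longest_path hG hα (fun v => (hreg' v).ge) (by omega) hP hmax h0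
    exact (SimpleGraph.not_exists_clique_of_regular hk hG hreg' hα hd hHS hH hHne hN hS hSk
      hW).elim
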